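/- Let $H=\mathrm{Homeo}^+([0,1])$ be the group of order-preserving homeomorphisms of $[0,1]$ under composition, with its natural (Polish) topology of pointwise convergence, whose basic open sets are $\{g\in H : |g(a_i)-f(a_i)|<\varepsilon,\ 1\le i\le k\}$ for $f\in H$, $a_1,\dots,a_k\in[0,1]$ and $\varepsilon>0$. Call two pairs $(g_1,g_2),(f_1,f_2)\in H\times H$ topologically similar if the map $g_1\mapsto f_1$, $g_2\mapsto f_2$ extends to a group isomorphism $\langle g_1,g_2\rangle\to\langle f_1,f_2\rangle$ between the generated subgroups that is a homeomorphism for the subspace topologies. This is an equivalence relation on $H\times H$, whose classes are called two-dimensional topological similarity classes. Then every two-dimensional topological similarity class in $H$ is a meager subset of $H\times H$. -/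

import Mathlib

/-- Two `n`-tuples `g`, `f` in a topological group are topologically similar if `g i ↦ f i` extends
to a bicontinuous isomorphism between the subgroups generated by the two tuples (with their
subspace topologies). -/
def TopologicallySimilar {G : Type*} [Group G] [TopologicalSpace G] [IsTopologicalGroup G]
    {n : ℕ} (g f : Fin n → G) : Prop :=
  ∃ F : Subgroup.closure (Set.range g) ≃ₜ* Subgroup.closure (Set.range f),
    ∀ i : Fin n, F ⟨g i, Subgroup.subset_closure (Set.mem_range_self i)⟩ =
      ⟨f i, Subgroup.subset_closure (Set.mem_range_self i)⟩

/-- The `n`-dimensional topological similarity class of the tuple `f`. -/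
def similarityClass {G : Type*} [Group G] [TopologicalSpace G] [IsTopologicalGroup G]
    {n : ℕ} (f : Fin n → G) : Set (Fin n → G) :=
  {g | TopologicallySimilar g f}

/-- The group of order-preserving homeomorphisms of `[0,1]`, with composition. -/
def HomeoPlus : Subgroup (unitInterval ≃ₜ unitInterval) where
  carrier := {f | StrictMono f}
  one_mem' := fun _ _ h => h
  mul_mem' := fun hf hg _ _ h => hf (hg h)
  inv_mem' := by
    intro f hf a b h
    have hf' : StrictMono f := hf
    rw [← hf'.lt_iff_lt]
    change f (f.symm a) < f (f.symm b)
    simpa using h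

/-- The topology of pointwise convergence on `HomeoPlus`: the sets
`{g | ∀ i, |g (a i) - f (a i)| < ε}`, for finitely many points `a i` and `ε > 0`, form a base. -/
instance HomeoPlus.instTopologicalSpace : TopologicalSpace HomeoPlus :=
  TopologicalSpace.induced (fun (f : HomeoPlus) (x : unitInterval) => f.1 x) inferInstance

theorem HomeoPlus.continuous_apply (x : unitInterval) :
    Continuous (fun f : HomeoPlus => f.1 x) :=
  (_root_.continuous_apply x).comp continuous_induced_dom

theorem HomeoPlus.continuous_eval :
    Continuous (fun p : HomeoPlus × unitInterval => p.1.1 p.2) := by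
  have key (f : HomeoPlus) (y : unitInterval) : f.1 (f.1.symm y) = y := f.1.apply_symm_apply y
  rw [continuous_iff_continuousAt]
  rintro ⟨f, x⟩
  refine tendsto_order.2 ⟨fun a ha => ?_, fun a ha => ?_⟩
  · have h1 : f.1.symm a < x := by
      have hf : StrictMono f.1 := f.2
      rw [← hf.lt_iff_lt, key]; exact ha
    obtain ⟨z, hz1, hz2⟩ := exists_between h1
    have h2 : a < f.1 z := by
      have h3 : f.1 (f.1.symm a) < f.1 z := f.2 hz1
      rwa [key] at h3
    have e1 := ((HomeoPlus.continuous_apply z).continuousAt (x := f)).eventually (lt_mem_nhds h2)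
    filter_upwards [e1.prod_nhds (lt_mem_nhds hz2)] with p hp
    exact hp.1.trans (p.1.2 hp.2)
  · have h1 : x < f.1.symm a := by
      have hf : StrictMono f.1 := f.2
      rw [← hf.lt_iff_lt, key]; exact ha
    obtain ⟨z, hz1, hz2⟩ := exists_between h1
    have h2 : f.1 z < a := by
      have h3 : f.1 z < f.1 (f.1.symm a) := f.2 hz2
      rwa [key] at h3
    have e1 := ((HomeoPlus.continuous_apply z).continuousAt (x := f)).eventually (gt_mem_nhds h2)
    filter_upwards [e1.prod_nhds (gt_mem_nhds hz1)] with p hp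
    exact lt_trans (p.1.2 hp.2) hp.1

instance HomeoPlus.instIsTopologicalGroup : IsTopologicalGroup HomeoPlus where
  continuous_mul := by
    refine continuous_induced_rng.2 (continuous_pi fun x => ?_)
    exact HomeoPlus.continuous_eval.comp
      (continuous_fst.prodMk ((HomeoPlus.continuous_apply x).comp continuous_snd))
  continuous_inv := by
    refine continuous_induced_rng.2 (continuous_pi fun x => ?_)
    have lt1 (f : HomeoPlus) (a : unitInterval) : a < f.1.symm x ↔ f.1 a < x := by
      have hf : StrictMono f.1 := f.2
      rw [← hf.lt_iff_lt, f.1.apply_symm_apply]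
    have lt2 (f : HomeoPlus) (a : unitInterval) : f.1.symm x < a ↔ x < f.1 a := by
      have hf : StrictMono f.1 := f.2
      rw [← hf.lt_iff_lt, f.1.apply_symm_apply]
    change Continuous fun f : HomeoPlus => f.1.symm x
    rw [continuous_iff_continuousAt]
    intro f
    refine tendsto_order.2 ⟨fun a ha => ?_, fun a ha => ?_⟩
    · filter_upwards [((HomeoPlus.continuous_apply a).continuousAt (x := f)).eventually
        (gt_mem_nhds ((lt1 f a).1 ha))] with g hg using (lt1 g a).2 hg
    · filter_upwards [((HomeoPlus.continuous_apply a).continuousAt (x := f)).eventually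
        (lt_mem_nhds ((lt2 f a).1 ha))] with g hg using (lt2 g a).2 hg

/-! Write `w(g)` for the value of a word `w` of the free group on two letters at a pair `g`.
Similarity makes words that are small at one pair small at the other. With a countable base `V k` at
the identity, this puts the class of `f` inside a countable union of closed sets, and it remains to
see that each has empty interior.

Suppose first that nontrivial words come arbitrarily close to the identity at `f`, relations
included. Fix `0 < t < s < 1`. The closed sets consist of the `g` such that `w(f) ∈ V k` forces `t ≤
w(g)(s)`. Inside any open set, finitely many values of `g` can be prescribed so that a suitable word
brings `s` below `t` (`exists_hasDescent`). Every further letter of a reduced word can then be made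
to push the point lower, because the point lies below everything prescribed so far
(`HasDescent.cons`). A bounded choice of conjugators makes any nontrivial `w` end in that suitable
word (`FreeGroup.exists_isReduced_conj`).

Otherwise `f` freely generates a discrete subgroup, and the closed sets consist of the `g` whose
nontrivial words avoid the interior of `V k`. They have empty interior because pairs satisfying a
relation are dense (`exists_mem_relation`): a word supported in `[α, ω]` commutes with a conjugate
supported in `[0, α]`. -/

namespace HomeoPlus

open Filter Topology

/-! ### Order homeomorphisms with prescribed values -/

theorem strictMono (g : HomeoPlus) : StrictMono g.1 := g.2

theorem inv_apply_self (g : HomeoPlus) (x : unitInterval) : (g⁻¹).1 (g.1 x) = x :=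
  g.1.symm_apply_apply x

theorem apply_inv_self (g : HomeoPlus) (x : unitInterval) : g.1 ((g⁻¹).1 x) = x :=
  g.1.apply_symm_apply x

theorem mul_apply (g h : HomeoPlus) (x : unitInterval) : (g * h).1 x = g.1 (h.1 x) := rfl

theorem one_apply (x : unitInterval) : (1 : HomeoPlus).1 x = x := rfl

theorem inv_apply_eq_iff (g : HomeoPlus) (x y : unitInterval) : (g⁻¹).1 x = y ↔ g.1 y = x := by
  constructor
  · rintro rfl; exact apply_inv_self g x
  · rintro rfl; exact inv_apply_self g y

theorem ext_apply {g h : HomeoPlus} (H : ∀ x, g.1 x = h.1 x) : g = h :=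
  Subtype.ext (Homeomorph.ext H)

theorem apply_zero (g : HomeoPlus) : g.1 0 = 0 := by
  refine le_antisymm ?_ unitInterval.nonneg'
  rw [← apply_inv_self g 0]
  exact (strictMono g).monotone (by rw [apply_inv_self]; exact unitInterval.nonneg')

theorem apply_one (g : HomeoPlus) : g.1 1 = 1 := by
  refine le_antisymm unitInterval.le_one' ?_
  rw [← apply_inv_self g 1]
  exact (strictMono g).monotone (by rw [apply_inv_self]; exact unitInterval.le_one')

theorem apply_pos (g : HomeoPlus) {x : unitInterval} (hx : 0 < x) : 0 < g.1 x := by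
  simpa only [apply_zero] using (strictMono g) hx

theorem apply_lt_one (g : HomeoPlus) {x : unitInterval} (hx : x < 1) : g.1 x < 1 := by
  simpa only [apply_one] using (strictMono g) hx

/-- A strictly increasing continuous real function on `[0,1]` fixing the endpoints is given by an
element of `HomeoPlus`. -/
theorem exists_of_strictMonoOn (φ : ℝ → ℝ) (hc : ContinuousOn φ (Set.Icc 0 1))
    (hm : StrictMonoOn φ (Set.Icc 0 1)) (h0 : φ 0 = 0) (h1 : φ 1 = 1) :
    ∃ g : HomeoPlus, ∀ x : unitInterval, (g.1 x : ℝ) = φ x := by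
  have hmem : ∀ x : unitInterval, φ x ∈ Set.Icc (0 : ℝ) 1 := fun x =>
    ⟨h0 ▸ hm.monotoneOn (by simp) x.2 x.2.1, h1 ▸ hm.monotoneOn x.2 (by simp) x.2.2⟩
  let ψ : unitInterval → unitInterval := fun x => ⟨φ x, hmem x⟩
  have hψ : StrictMono ψ := fun x y hxy => hm x.2 y.2 hxy
  have hs : Function.Surjective ψ := by
    intro y
    obtain ⟨x, hx, hxy⟩ := intermediate_value_Icc zero_le_one hc (by rw [h0, h1]; exact y.2)
    exact ⟨⟨x, hx⟩, Subtype.ext hxy⟩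
  exact ⟨⟨(hψ.orderIsoOfSurjective ψ hs).toHomeomorph, hψ⟩, fun x => rfl⟩

/-- Interpolate affinely on `[α, β]` between the values `h α` and `k β`. -/
theorem exists_glue (h k : HomeoPlus) {α β : unitInterval} (hαβ : α < β)
    (hv : h.1 α < k.1 β) :
    ∃ g : HomeoPlus, (∀ x ≤ α, g.1 x = h.1 x) ∧ (∀ x, β ≤ x → g.1 x = k.1 x) := by
  have hαβ' : (α : ℝ) < β := hαβ
  have hv' : (h.1 α : ℝ) < k.1 β := hv
  set s : ℝ := ((k.1 β : ℝ) - h.1 α) / (β - α) with hs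
  have hs0 : 0 < s := div_pos (sub_pos.2 hv') (sub_pos.2 hαβ')
  have hsm : s * (β - α) = (k.1 β : ℝ) - h.1 α := div_mul_cancel₀ _ (sub_pos.2 hαβ').ne'
  let H : ℝ → ℝ := fun x => h.1 (Set.projIcc 0 1 zero_le_one x)
  let K : ℝ → ℝ := fun x => k.1 (Set.projIcc 0 1 zero_le_one x)
  have cH : Continuous H := by
    exact continuous_subtype_val.comp (h.1.continuous.comp continuous_projIcc)
  have cK : Continuous K := by
    exact continuous_subtype_val.comp (k.1.continuous.comp continuous_projIcc)
  have vH (x : unitInterval) : H x = h.1 x := by simp [H]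
  have vK (x : unitInterval) : K x = k.1 x := by simp [K]
  have mH : StrictMonoOn H (Set.Icc 0 1) := by
    intro x hx y hy hxy
    have := (strictMono h) (show (⟨x, hx⟩ : unitInterval) < ⟨y, hy⟩ from hxy)
    rw [← Subtype.coe_lt_coe, ← vH, ← vH] at this
    exact this
  have mK : StrictMonoOn K (Set.Icc 0 1) := by
    intro x hx y hy hxy
    have := (strictMono k) (show (⟨x, hx⟩ : unitInterval) < ⟨y, hy⟩ from hxy)
    rw [← Subtype.coe_lt_coe, ← vK, ← vK] at this
    exact this
  let φ : ℝ → ℝ := fun x => if x ≤ α then H x else if x ≤ β then h.1 α + s * (x - α) else K x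
  have φ1 : ∀ x : ℝ, x ≤ α → φ x = H x := fun x hx => if_pos hx
  have φ2 : ∀ x : ℝ, (α : ℝ) ≤ x → x ≤ β → φ x = h.1 α + s * (x - α) := by
    intro x hx hx'
    rcases hx.eq_or_lt with rfl | hx
    · rw [φ1 _ le_rfl, vH]; ring
    · simp only [φ, not_le.2 hx, if_false, hx', if_true]
  have φ3 : ∀ x : ℝ, (β : ℝ) ≤ x → φ x = K x := by
    intro x hx
    rcases hx.eq_or_lt with rfl | hx
    · rw [φ2 _ hαβ'.le le_rfl, vK]; linarith
    · simp only [φ, not_le.2 hx, not_le.2 (hαβ'.trans hx), if_false]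
  have hc : Continuous φ := by
    refine Continuous.if_le cH (Continuous.if_le (by fun_prop) cK continuous_id
      continuous_const ?_) continuous_id continuous_const ?_
    · rintro x rfl; rw [vK]; linarith
    · rintro x rfl; rw [if_pos hαβ'.le, vH]; ring
  have i1 : StrictMonoOn φ (Set.Icc 0 α) := by
    intro x hx y hy hxy
    rw [φ1 x hx.2, φ1 y hy.2]
    exact mH ⟨hx.1, hx.2.trans α.2.2⟩ ⟨hy.1, hy.2.trans α.2.2⟩ hxy
  have i2 : StrictMonoOn φ (Set.Icc α β) := by
    intro x hx y hy hxy
    rw [φ2 x hx.1 hx.2, φ2 y hy.1 hy.2]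
    nlinarith
  have i3 : StrictMonoOn φ (Set.Icc β 1) := by
    intro x hx y hy hxy
    rw [φ3 x hx.1, φ3 y hy.1]
    exact mK ⟨β.2.1.trans hx.1, hx.2⟩ ⟨β.2.1.trans hy.1, hy.2⟩ hxy
  have i12 : StrictMonoOn φ (Set.Icc 0 β) := by
    have := i1.union i2 (isGreatest_Icc α.2.1) (isLeast_Icc hαβ'.le)
    rwa [Set.Icc_union_Icc_eq_Icc α.2.1 hαβ'.le] at this
  have i : StrictMonoOn φ (Set.Icc 0 1) := by
    have := i12.union i3 (isGreatest_Icc β.2.1) (isLeast_Icc β.2.2)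
    rwa [Set.Icc_union_Icc_eq_Icc β.2.1 β.2.2] at this
  obtain ⟨g, hg⟩ := exists_of_strictMonoOn φ hc.continuousOn i
    (by rw [φ1 0 α.2.1]; exact (vH 0).trans (by rw [apply_zero]; rfl))
    (by rw [φ3 1 β.2.2]; exact (vK 1).trans (by rw [apply_one]; rfl))
  refine ⟨g, fun x hx => Subtype.ext ?_, fun x hx => Subtype.ext ?_⟩
  · rw [hg, φ1 _ hx, vH]
  · rw [hg, φ3 _ hx, vK]

/-- A power map `x ^ r` does it, with `r = log q / log p > 0`. -/
theorem exists_apply_eq {p q : unitInterval} (hp0 : 0 < p) (hp1 : p < 1) (hq0 : 0 < q)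
    (hq1 : q < 1) : ∃ g : HomeoPlus, g.1 p = q := by
  have hp0' : (0 : ℝ) < p := hp0
  have hp1' : (p : ℝ) < 1 := hp1
  have hq0' : (0 : ℝ) < q := hq0
  have hq1' : (q : ℝ) < 1 := hq1
  obtain ⟨g, hg⟩ := exists_of_strictMonoOn (fun x => x ^ (Real.log q / Real.log p))
    (Continuous.continuousOn (Real.continuous_rpow_const
      (div_pos_of_neg_of_neg (Real.log_neg hq0' hq1') (Real.log_neg hp0' hp1')).le))
    (fun x hx y _ hxy => Real.rpow_lt_rpow hx.1 hxy
      (div_pos_of_neg_of_neg (Real.log_neg hq0' hq1') (Real.log_neg hp0' hp1')))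
    (Real.zero_rpow (div_pos_of_neg_of_neg (Real.log_neg hq0' hq1') (Real.log_neg hp0' hp1')).ne')
    (Real.one_rpow _)
  refine ⟨g, Subtype.ext ?_⟩
  rw [hg, Real.rpow_def_of_pos hp0', mul_div_cancel₀ _ (Real.log_neg hp0' hp1').ne,
    Real.exp_log hq0']

/-- Points of an open interval can be moved to each other by an element supported there. -/
theorem exists_apply_eq_of_mem_Ioo {a b p q : unitInterval} (hp : p ∈ Set.Ioo a b)
    (hq : q ∈ Set.Ioo a b) :
    ∃ g : HomeoPlus, g.1 p = q ∧ (∀ x ≤ a, g.1 x = x) ∧ (∀ x, b ≤ x → g.1 x = x) := by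
  obtain ⟨k, hk⟩ := exists_apply_eq (unitInterval.nonneg'.trans_lt hp.1)
    (hp.2.trans_le unitInterval.le_one') (unitInterval.nonneg'.trans_lt hq.1)
    (hq.2.trans_le unitInterval.le_one')
  obtain ⟨l, hl1, hl2⟩ := exists_glue 1 k hp.1 (by rw [hk]; exact hq.1)
  have hlp : l.1 p = q := (hl2 p le_rfl).trans hk
  obtain ⟨m, hm1, hm2⟩ := exists_glue l 1 hp.2 (by rw [hlp]; exact hq.2)
  exact ⟨m, (hm1 p le_rfl).trans hlp, fun x hx => (hm1 x (hx.trans hp.1.le)).trans (hl1 x hx), hm2⟩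

/-! ### The topology of pointwise convergence -/

theorem isInducing_apply :
    IsInducing (fun (f : HomeoPlus) (x : unitInterval) => f.1 x) := ⟨rfl⟩

/-- Values on a countable dense set `D` determine the topology: for `x < 1`, `f x < a` holds iff `f
d < a` for some `d > x` in `D`, and dually for `x > 0`. The endpoints are fixed by every `f`. This
supplies the countable base at the identity. -/
instance : SecondCountableTopology HomeoPlus := by
  obtain ⟨D, hDc, hD⟩ := TopologicalSpace.exists_countable_dense unitInterval
  have : Countable D := hDc
  let r : HomeoPlus → D → unitInterval := fun f d => f.1 d
  have key (x a : unitInterval) : IsOpen[.induced r inferInstance] {f : HomeoPlus | f.1 x < a} ∧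
      IsOpen[.induced r inferInstance] {f : HomeoPlus | a < f.1 x} := by
    let t : TopologicalSpace HomeoPlus := .induced r inferInstance
    have hr : ∀ d : D, Continuous[t, _] (fun f : HomeoPlus => f.1 d) := fun d =>
      (_root_.continuous_apply d).comp (@continuous_induced_dom _ _ r _)
    constructor
    · rcases eq_or_lt_of_le (unitInterval.le_one' (t := x)) with rfl | hx
      · simp only [apply_one]; exact isOpen_const
      · have : {f : HomeoPlus | f.1 x < a} = ⋃ d : {d : D // x < d}, {f | f.1 d.1 < a} := by
          ext f
          simp only [Set.mem_ofPred_eq, Set.mem_iUnion]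
          constructor
          · intro h
            have : ∀ᶠ y in 𝓝[>] x, f.1 y < a :=
              (f.1.continuous.tendsto x).eventually (gt_mem_nhds h) |>.filter_mono
                nhdsWithin_le_nhds
            obtain ⟨u, hu, hu2⟩ := (mem_nhdsGT_iff_exists_Ioo_subset' hx).1 this
            obtain ⟨d, hd, hd2⟩ := hD.exists_between hu
            exact ⟨⟨⟨d, hd⟩, hd2.1⟩, hu2 hd2⟩
          · rintro ⟨d, hd⟩
            exact (f.2 d.2).trans hd
        rw [this]
        exact isOpen_iUnion fun d => isOpen_lt (hr d.1) continuous_const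
    · rcases eq_or_lt_of_le (unitInterval.nonneg' (t := x)) with rfl | hx
      · simp only [apply_zero]; exact isOpen_const
      · have : {f : HomeoPlus | a < f.1 x} = ⋃ d : {d : D // d < x}, {f | a < f.1 d.1} := by
          ext f
          simp only [Set.mem_ofPred_eq, Set.mem_iUnion]
          constructor
          · intro h
            have : ∀ᶠ y in 𝓝[<] x, a < f.1 y :=
              (f.1.continuous.tendsto x).eventually (lt_mem_nhds h) |>.filter_mono
                nhdsWithin_le_nhds
            obtain ⟨u, hu, hu2⟩ := (mem_nhdsLT_iff_exists_Ioo_subset' hx).1 this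
            obtain ⟨d, hd, hd2⟩ := hD.exists_between hu
            exact ⟨⟨⟨d, hd⟩, hd2.2⟩, hu2 hd2⟩
          · rintro ⟨d, hd⟩
            exact hd.trans (f.2 d.2)
        rw [this]
        exact isOpen_iUnion fun d => isOpen_lt continuous_const (hr d.1)
  have heq : HomeoPlus.instTopologicalSpace = .induced r inferInstance := by
    refine le_antisymm ?_ ?_
    · rw [← continuous_iff_le_induced]
      exact continuous_pi fun d => HomeoPlus.continuous_apply d
    · refine continuous_iff_le_induced.1 (@continuous_pi _ _ _ (.induced r inferInstance) _ _
        fun x => ?_)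
      refine (@OrderTopology.continuous_iff _ _ _ _ _ (.induced r inferInstance) _).2 fun a => ?_
      exact ⟨(key x a).2, (key x a).1⟩
  exact @IsInducing.secondCountableTopology _ _ _ _ _ _ ⟨heq⟩

/-- Membership in an open set of tuples depends on finitely many values only. -/
theorem exists_finset_of_isOpen {n : ℕ} {U : Set (Fin n → HomeoPlus)} (hU : IsOpen U)
    {h : Fin n → HomeoPlus} (hh : h ∈ U) :
    ∃ A : Finset unitInterval, ∀ g : Fin n → HomeoPlus,
      (∀ i, ∀ a ∈ A, (g i).1 a = (h i).1 a) → g ∈ U := by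
  obtain ⟨I, u, hu, huU⟩ := isOpen_pi_iff.1 hU h hh
  have H (i : Fin n) : ∃ A : Finset unitInterval, i ∈ I → ∀ g : HomeoPlus,
      (∀ a ∈ A, g.1 a = (h i).1 a) → g ∈ u i := by
    by_cases hi : i ∈ I
    · obtain ⟨V, hV, hVu⟩ := isOpen_induced_iff.1 (hu i hi).1
      obtain ⟨A, v, hv, hvV⟩ := isOpen_pi_iff.1 hV (fun x => (h i).1 x)
        (by have := (hu i hi).2; rw [← hVu] at this; exact this)
      refine ⟨A, fun _ g hg => ?_⟩
      rw [← hVu]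
      refine hvV fun a ha => ?_
      change g.1 a ∈ v a
      rw [hg a ha]
      exact (hv a ha).2
    · exact ⟨∅, fun h => absurd h hi⟩
  choose A hA using H
  refine ⟨Finset.univ.biUnion A, fun g hg => huU fun i hi => hA i hi (g i) fun a ha => hg i a ?_⟩
  exact Finset.mem_biUnion.2 ⟨i, Finset.mem_univ i, ha⟩

theorem tendsto_iff_apply {ι : Type*} {l : Filter ι} {g : ι → HomeoPlus} {h : HomeoPlus} :
    Tendsto g l (𝓝 h) ↔ ∀ x, Tendsto (fun n => (g n).1 x) l (𝓝 (h.1 x)) := by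
  rw [isInducing_apply.tendsto_nhds_iff, tendsto_pi_nhds]
  rfl

/-- Elements arbitrarily close to the identity move any given interior point. -/
theorem exists_mem_nhds_apply_ne {V : Set HomeoPlus} (hV : V ∈ 𝓝 1) {p : unitInterval}
    (hp0 : 0 < p) (hp1 : p < 1) : ∃ m ∈ V, m.1 p ≠ p := by
  have H (n : ℕ) : ∃ m : HomeoPlus, m.1 p ≠ p ∧ ∀ x, dist (m.1 x) x < 1 / ((n : ℝ) + 1) := by
    have hε : 0 < 1 / ((n : ℝ) + 1) := Nat.one_div_pos_of_nat
    obtain ⟨a, ha, hap⟩ := exists_between (show max (0 : ℝ) (p - 1 / ((n : ℝ) + 1) / 2) < p from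
      max_lt hp0 (by linarith))
    obtain ⟨b, hpb, hb⟩ := exists_between (show (p : ℝ) < min 1 (p + 1 / ((n : ℝ) + 1) / 2) from
      lt_min hp1 (by linarith))
    rw [max_lt_iff] at ha
    rw [lt_min_iff] at hb
    let a' : unitInterval := ⟨a, ha.1.le, (hap.trans hp1).le⟩
    let b' : unitInterval := ⟨b, p.2.1.trans hpb.le, hb.1.le⟩
    have hpb' : p < b' := hpb
    have hap' : a' < p := hap
    obtain ⟨q, hpq, hqb⟩ := exists_between hpb'
    obtain ⟨m, hm, hma, hmb⟩ := exists_apply_eq_of_mem_Ioo ⟨hap', hpb'⟩ ⟨hap'.trans hpq, hqb⟩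
    refine ⟨m, by rw [hm]; exact hpq.ne', fun x => ?_⟩
    rcases le_total x a' with hxa | hxa
    · rw [hma x hxa, dist_self]; exact hε
    rcases le_total b' x with hxb | hxb
    · rw [hmb x hxb, dist_self]; exact hε
    have h1 : a ≤ m.1 x := by
      have := (strictMono m).monotone hxa
      rwa [hma a' le_rfl] at this
    have h2 : m.1 x ≤ b := by
      have := (strictMono m).monotone hxb
      rwa [hmb b' le_rfl] at this
    have h3 : a ≤ x := hxa
    have h4 : (x : ℝ) ≤ b := hxb
    rw [Subtype.dist_eq, Real.dist_eq, abs_lt]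
    constructor <;> linarith
  choose m hm hd using H
  have ht : Tendsto m atTop (𝓝 1) := by
    refine tendsto_iff_apply.2 fun x => ?_
    rw [one_apply, tendsto_iff_dist_tendsto_zero]
    exact squeeze_zero (fun _ => dist_nonneg) (fun n => (hd n x).le)
      tendsto_one_div_add_atTop_nhds_zero_nat
  obtain ⟨n, hn⟩ := (ht.eventually hV).exists
  exact ⟨m n, hn, hm n⟩

theorem dense_setOf_apply_ne {p : unitInterval} (hp0 : 0 < p) (hp1 : p < 1) :
    Dense {g : HomeoPlus | g.1 p ≠ p} := by
  rw [dense_iff_inter_open]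
  rintro U hU ⟨k, hk⟩
  by_cases h : k.1 p = p
  · have hV : {m : HomeoPlus | k * m ∈ U} ∈ 𝓝 1 :=
      (continuous_const_mul k).continuousAt.preimage_mem_nhds (by
        rw [mul_one]; exact hU.mem_nhds hk)
    obtain ⟨m, hm, hmp⟩ := exists_mem_nhds_apply_ne hV hp0 hp1
    refine ⟨k * m, hm, fun h' => hmp (k.1.injective ?_)⟩
    rw [h]; exact h'
  · exact ⟨k, hk, h⟩

theorem isOpen_setOf_apply_ne (p : unitInterval) : IsOpen {g : HomeoPlus | g.1 p ≠ p} :=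
  isOpen_ne_fun (HomeoPlus.continuous_apply p) continuous_const

theorem dense_setOf_forall_apply_ne (S : Finset unitInterval) (hS : ∀ p ∈ S, 0 < p ∧ p < 1) :
    IsOpen {g : HomeoPlus | ∀ p ∈ S, g.1 p ≠ p} ∧ Dense {g : HomeoPlus | ∀ p ∈ S, g.1 p ≠ p} := by
  induction S using Finset.induction_on with
  | empty => simp
  | insert a S _ ih =>
    have ih := ih fun p hp => hS p (Finset.mem_insert_of_mem hp)
    have ha := hS a (Finset.mem_insert_self a S)
    have : {g : HomeoPlus | ∀ p ∈ insert a S, g.1 p ≠ p} =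
        {g : HomeoPlus | g.1 a ≠ a} ∩ {g : HomeoPlus | ∀ p ∈ S, g.1 p ≠ p} := by
      ext g; simp
    rw [this]
    exact ⟨(isOpen_setOf_apply_ne a).inter ih.1,
      (dense_setOf_apply_ne ha.1 ha.2).inter_of_isOpen_left ih.2 (isOpen_setOf_apply_ne a)⟩

end HomeoPlus

/-! ### Bernstein polynomials with increasing coefficients -/

open Polynomial in
theorem derivative_sum_bernsteinPolynomial (n : ℕ) (c : ℕ → ℝ) :
    derivative (∑ k ∈ Finset.range (n + 1), C (c k) * bernsteinPolynomial ℝ n k) =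
      n * ∑ k ∈ Finset.range n, C (c (k + 1) - c k) * bernsteinPolynomial ℝ (n - 1) k := by
  rcases n with _ | n
  · simp [bernsteinPolynomial]
  -- Summation by parts: the same sum is split at its bottom and at its top, where the polynomial of
  -- index `n + 1` in degree `n` vanishes.
  have h1 := Finset.sum_range_succ' (fun k => C (c k) * bernsteinPolynomial ℝ n k) (n + 1)
  rw [Finset.sum_range_succ, bernsteinPolynomial.eq_zero_of_lt ℝ (Nat.lt_succ_self n)] at h1
  rw [Finset.sum_range_succ']
  simp only [derivative_add, derivative_sum, derivative_C_mul, bernsteinPolynomial.derivative_succ,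
    bernsteinPolynomial.derivative_zero, Nat.add_sub_cancel, C_sub, sub_mul,
    Finset.sum_sub_distrib, Finset.mul_sum, mul_sub]
  have h2 : ∀ (d : ℕ → ℝ[X]) (e : ℕ → ℝ[X]),
      ∑ x ∈ Finset.range (n + 1), d x * (((n + 1 : ℕ) : ℝ[X]) * e x) =
        ((n + 1 : ℕ) : ℝ[X]) * ∑ x ∈ Finset.range (n + 1), d x * e x := by
    intro d e
    rw [Finset.mul_sum]
    exact Finset.sum_congr rfl fun x _ => by ring
  simp only [h2, ← Finset.mul_sum]
  linear_combination ((n + 1 : ℕ) : ℝ[X]) * h1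

open Polynomial in
theorem strictMonoOn_sum_bernsteinPolynomial {n : ℕ} (hn : n ≠ 0) {c : ℕ → ℝ}
    (hc : ∀ k < n, c k < c (k + 1)) :
    StrictMonoOn (fun x : ℝ =>
      (∑ k ∈ Finset.range (n + 1), C (c k) * bernsteinPolynomial ℝ n k).eval x) (Set.Icc 0 1) := by
  refine strictMonoOn_of_deriv_pos (convex_Icc 0 1) (Polynomial.continuous _).continuousOn ?_
  intro x hx
  rw [interior_Icc] at hx
  rw [Polynomial.deriv, derivative_sum_bernsteinPolynomial, eval_mul, eval_natCast,
    eval_finsetSum]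
  refine mul_pos (by positivity) (Finset.sum_pos (fun k hk => ?_) ⟨0, by simpa using hn.bot_lt⟩)
  have hk : k < n := Finset.mem_range.1 hk
  rw [eval_mul, eval_C]
  refine mul_pos (sub_pos.2 (hc k hk)) ?_
  have h1 : 0 < x := hx.1
  have h2 : 0 < 1 - x := sub_pos.2 hx.2
  have h3 : 0 < (n - 1).choose k := Nat.choose_pos (by omega)
  simp only [bernsteinPolynomial, eval_mul, eval_natCast, eval_pow, eval_X, eval_sub, eval_one]
  positivity

/-! ### Density of pairs without common fixed points -/

namespace HomeoPlus

open Filter Topology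

/-- Bernstein approximations of `h`, as elements of `HomeoPlus`. -/
theorem exists_polynomial_tendsto (h : HomeoPlus) :
    ∃ (g : ℕ → HomeoPlus) (P : ℕ → Polynomial ℝ),
      (∀ n x, ((g n).1 x : ℝ) = (P n).eval (x : ℝ)) ∧ Tendsto g atTop (𝓝 h) := by
  let f : C(unitInterval, ℝ) := ⟨fun x => h.1 x, continuous_subtype_val.comp h.1.continuous⟩
  let c : ℕ → ℕ → ℝ := fun n k => f (Set.projIcc 0 1 zero_le_one ((k : ℝ) / n))
  -- The degree is `n + 1`, since degree `0` would give a constant.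
  let P : ℕ → Polynomial ℝ := fun n =>
    ∑ k ∈ Finset.range (n + 1 + 1), Polynomial.C (c (n + 1) k) * bernsteinPolynomial ℝ (n + 1) k
  have hP (n : ℕ) (x : unitInterval) :
      bernsteinApproximation (n + 1) f x = (P n).eval (x : ℝ) := by
    rw [bernsteinApproximation.apply, Polynomial.eval_finsetSum, ← Fin.sum_univ_eq_sum_range
      (fun k => (Polynomial.C (c (n + 1) k) * bernsteinPolynomial ℝ (n + 1) k).eval (x : ℝ))]
    refine Finset.sum_congr rfl fun k _ => ?_
    rw [Polynomial.eval_mul, Polynomial.eval_C, smul_eq_mul, mul_comm]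
    congr 1
    simp only [c]
    congr 1
    have := (bernstein.z k).2
    rw [Set.projIcc_of_mem zero_le_one (show ((k : ℕ) : ℝ) / ((n + 1 : ℕ) : ℝ) ∈ Set.Icc 0 1 from
      this)]
    rfl
  have hmono (n : ℕ) : StrictMonoOn (fun x : ℝ => (P n).eval x) (Set.Icc 0 1) := by
    refine strictMonoOn_sum_bernsteinPolynomial n.succ_ne_zero fun k hk => ?_
    have hn : (0 : ℝ) < ((n + 1 : ℕ) : ℝ) := by positivity
    have hk' : ((k + 1 : ℕ) : ℝ) ≤ ((n + 1 : ℕ) : ℝ) := by exact_mod_cast hk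
    have hlt : (k : ℝ) / ((n + 1 : ℕ) : ℝ) < ((k + 1 : ℕ) : ℝ) / ((n + 1 : ℕ) : ℝ) := by
      gcongr; exact Nat.lt_succ_self k
    refine strictMono h (Set.strictMonoOn_projIcc zero_le_one ?_ ?_ hlt)
    · exact ⟨by positivity, hlt.le.trans ((div_le_one hn).2 hk')⟩
    · exact ⟨by positivity, (div_le_one hn).2 hk'⟩
  have hg (n : ℕ) : ∃ g : HomeoPlus, ∀ x : unitInterval, (g.1 x : ℝ) = (P n).eval (x : ℝ) := by
    refine exists_of_strictMonoOn _ (P n).continuous.continuousOn (hmono n) ?_ ?_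
    · have := hP n 0
      rw [bernsteinApproximation.apply_zero] at this
      refine this.symm.trans ?_
      change ((h.1 0 : unitInterval) : ℝ) = 0
      rw [apply_zero]; rfl
    · have := hP n 1
      rw [bernsteinApproximation.apply_one n.succ_ne_zero] at this
      refine this.symm.trans ?_
      change ((h.1 1 : unitInterval) : ℝ) = 1
      rw [apply_one]; rfl
  choose g hg using hg
  refine ⟨g, P, hg, tendsto_iff_apply.2 fun x => tendsto_subtype_rng.2 ?_⟩
  have h1 := ((bernsteinApproximation_uniform f).comp (tendsto_add_atTop_nat 1))
  have h2 := ((continuous_eval_const (F := C(unitInterval, ℝ)) x).tendsto f).comp h1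
  refine h2.congr fun n => ?_
  exact (hP n x).trans (hg n x).symm

/-- Elements with finitely many fixed points are dense. -/
theorem exists_mem_finite_fixedPoints {U : Set HomeoPlus} (hU : IsOpen U) (hne : U.Nonempty) :
    ∃ g ∈ U, ∃ S : Finset unitInterval, ∀ x, g.1 x = x → x ∈ S := by
  obtain ⟨p, hp0, hp1⟩ := exists_between (zero_lt_one (α := unitInterval))
  -- Approximating an `h` that moves `p` keeps the polynomials different from `X`, so their fixed
  -- points are roots of a nonzero polynomial.
  obtain ⟨h, hhU, hh⟩ := (dense_setOf_apply_ne hp0 hp1).inter_open_nonempty U hU hne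
  obtain ⟨g, P, hgP, hg⟩ := exists_polynomial_tendsto h
  obtain ⟨n, hnU, hn⟩ := ((hg.eventually (hU.mem_nhds hhU)).and
    (hg.eventually ((isOpen_setOf_apply_ne p).mem_nhds hh))).exists
  have hPX : P n - Polynomial.X ≠ 0 := by
    intro h0
    refine hn (Subtype.ext ?_)
    rw [hgP, sub_eq_zero.1 h0, Polynomial.eval_X]
  have hfin : {x : unitInterval | (g n).1 x = x}.Finite := by
    refine Set.Finite.preimage (f := ((↑) : unitInterval → ℝ)) Subtype.val_injective.injOn
      (Polynomial.finite_setOfPred_isRoot hPX) |>.subset fun x hx => ?_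
    have hx' : (g n).1 x = x := hx
    change (P n - Polynomial.X).eval (x : ℝ) = 0
    rw [Polynomial.eval_sub, Polynomial.eval_X, ← hgP, hx', sub_self]
  exact ⟨g n, hnU, hfin.toFinset, fun x hx => hfin.mem_toFinset.2 hx⟩

/-- Pairs that agree near both endpoints and have no common fixed point in `(0,1)` are dense. -/
theorem exists_mem_no_common_fixedPoint {U : Set (Fin 2 → HomeoPlus)} (hU : IsOpen U)
    (hne : U.Nonempty) :
    ∃ g ∈ U, ∃ α ω : unitInterval, 0 < α ∧ α < ω ∧ ω < 1 ∧
      (∀ x ≤ α, (g 0).1 x = (g 1).1 x) ∧ (∀ x, ω ≤ x → (g 0).1 x = (g 1).1 x) ∧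
      ∀ x, 0 < x → x < 1 → ∃ i, (g i).1 x ≠ x := by
  obtain ⟨h, hh⟩ := hne
  have c0 : Continuous fun k : HomeoPlus => Function.update h 0 k :=
    continuous_const.update 0 continuous_id
  obtain ⟨a, haU, S, hS⟩ := exists_mem_finite_fixedPoints (hU.preimage c0)
    ⟨h 0, by simpa using hh⟩
  have c1 : Continuous fun k : HomeoPlus => Function.update (Function.update h 0 a) 1 k :=
    continuous_const.update 1 continuous_id
  -- The second coordinate is chosen to move the finitely many interior fixed points of the first.
  obtain ⟨k, hkU, hk⟩ := (dense_setOf_forall_apply_ne (S.filter fun p => 0 < p ∧ p < 1)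
    (by simp)).2.inter_open_nonempty _ (hU.preimage c1)
    ⟨Function.update h 0 a 1, by rw [Set.mem_preimage, Function.update_eq_self]; exact haU⟩
  obtain ⟨A, hA⟩ := exists_finset_of_isOpen hU hkU
  obtain ⟨p, hp0, hp1⟩ := exists_between (zero_lt_one (α := unitInterval))
  -- The modified second map must keep the values of `k` on `A`, to stay in `U`, and on `S`, to keep
  -- moving the fixed points of `a`; `p` makes `T` nonempty.
  let T : Finset unitInterval := insert p ((A ∪ S).filter fun p => 0 < p ∧ p < 1)
  have hT : ∀ t ∈ T, 0 < t ∧ t < 1 := by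
    intro t ht
    rcases Finset.mem_insert.1 ht with rfl | ht
    · exact ⟨hp0, hp1⟩
    · exact (Finset.mem_filter.1 ht).2
  have hTne : T.Nonempty := ⟨p, Finset.mem_insert_self _ _⟩
  obtain ⟨β, hβ0, hβ⟩ := exists_between (hT _ (T.min'_mem hTne)).1
  obtain ⟨γ, hγ, hγ1⟩ := exists_between (hT _ (T.max'_mem hTne)).2
  have hβT : ∀ t ∈ T, β < t := fun t ht => hβ.trans_le (T.min'_le t ht)
  have hγT : ∀ t ∈ T, t < γ := fun t ht => (T.le_max' t ht).trans_lt hγ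
  have hβγ : β < γ := (hβT p (Finset.mem_insert_self _ _)).trans (hγT p (Finset.mem_insert_self _ _))
  -- The bound `α < a⁻¹ (k β)` says `a α < k β`, as gluing requires; `ω` is chosen likewise.
  obtain ⟨α, hα0, hα⟩ := exists_between (show 0 < min β ((a⁻¹).1 (k.1 β)) from
    lt_min hβ0 (apply_pos _ (apply_pos _ hβ0)))
  obtain ⟨hαβ, hα⟩ := lt_min_iff.1 hα
  obtain ⟨l, hl1, hl2⟩ := exists_glue a k hαβ (by
    have := strictMono a hα
    rwa [apply_inv_self] at this)
  obtain ⟨ω, hω, hω1⟩ := exists_between (show max γ ((a⁻¹).1 (l.1 γ)) < 1 from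
    max_lt hγ1 (apply_lt_one _ (apply_lt_one _ hγ1)))
  obtain ⟨hγω, hω⟩ := max_lt_iff.1 hω
  obtain ⟨m, hm1, hm2⟩ := exists_glue l a hγω (by
    have := strictMono a hω
    rwa [apply_inv_self] at this)
  have hmk : ∀ t ∈ T, m.1 t = k.1 t := fun t ht =>
    (hm1 t (hγT t ht).le).trans (hl2 t (hβT t ht).le)
  refine ⟨![a, m], hA _ ?_, α, ω, hα0, hαβ.trans (hβγ.trans hγω), hω1, ?_, ?_, ?_⟩
  · intro i x hx
    rcases eq_or_lt_of_le (unitInterval.nonneg' (t := x)) with rfl | hx0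
    · rw [apply_zero, apply_zero]
    rcases eq_or_lt_of_le (unitInterval.le_one' (t := x)) with rfl | hx1
    · rw [apply_one, apply_one]
    fin_cases i
    · rfl
    · exact hmk x (Finset.mem_insert_of_mem
        (Finset.mem_filter.2 ⟨Finset.mem_union_left _ hx, hx0, hx1⟩))
  · intro x hx
    exact ((hm1 x (hx.trans (hαβ.trans hβγ).le)).trans (hl1 x hx)).symm
  · intro x hx
    exact (hm2 x hx).symm
  · intro x hx0 hx1
    by_cases hax : a.1 x = x
    · have hxS := hS x hax
      refine ⟨1, ?_⟩
      change m.1 x ≠ x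
      rw [hmk x (Finset.mem_insert_of_mem
        (Finset.mem_filter.2 ⟨Finset.mem_union_right _ hxS, hx0, hx1⟩))]
      exact hk x (Finset.mem_filter.2 ⟨hxS, hx0, hx1⟩)
    · exact ⟨0, hax⟩

/-- Without common fixed points in `(0,1)`, orbits accumulate at `0`. -/
theorem exists_lift_apply_lt {g : Fin 2 → HomeoPlus}
    (hg : ∀ x, 0 < x → x < 1 → ∃ i, (g i).1 x ≠ x) {p δ : unitInterval} (hp : p < 1)
    (hδ : 0 < δ) : ∃ w : FreeGroup (Fin 2), (FreeGroup.lift g w).1 p < δ := by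
  let O : Set unitInterval := Set.range fun w : FreeGroup (Fin 2) => (FreeGroup.lift g w).1 p
  -- A positive infimum would be moved down by some generator or its inverse, and orbit points close
  -- to it would follow below the infimum.
  have hc : sInf O = 0 := by
    by_contra hne
    have h0 : 0 < sInf O := unitInterval.pos_iff_ne_zero.2 hne
    have h1 : sInf O < 1 := lt_of_le_of_lt (sInf_le ⟨1, by simp only [map_one, one_apply]⟩) hp
    obtain ⟨v, hv⟩ : ∃ v : FreeGroup (Fin 2), (FreeGroup.lift g v).1 (sInf O) < sInf O := by
      obtain ⟨i, hi⟩ := hg _ h0 h1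
      rcases hi.lt_or_gt with hi | hi
      · exact ⟨FreeGroup.of i, by rwa [FreeGroup.lift_apply_of]⟩
      · refine ⟨(FreeGroup.of i)⁻¹, ?_⟩
        rw [map_inv, FreeGroup.lift_apply_of]
        have := strictMono (g i)⁻¹ hi
        rwa [inv_apply_self] at this
    have hv' : sInf O < ((FreeGroup.lift g v)⁻¹).1 (sInf O) := by
      have := strictMono (FreeGroup.lift g v)⁻¹ hv
      rwa [inv_apply_self] at this
    obtain ⟨_, ⟨w, rfl⟩, hw⟩ := sInf_lt_iff.1 hv'
    have h2 := strictMono (FreeGroup.lift g v) hw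
    rw [apply_inv_self] at h2
    refine absurd (sInf_le (show (FreeGroup.lift g (v * w)).1 p ∈ O from ⟨_, rfl⟩)) (not_le.2 ?_)
    rw [map_mul, mul_apply]
    exact h2
  rw [← hc] at hδ
  obtain ⟨_, ⟨w, rfl⟩, hw⟩ := sInf_lt_iff.1 hδ
  exact ⟨w, hw⟩

end HomeoPlus

/-! ### Commutation in free groups -/

namespace FreeGroup

theorem eq_of_commute_of {α : Type*} [DecidableEq α] {a b : α} (h : Commute (of a) (of b)) :
    a = b := by
  have h1 := congrArg toWord h.eq
  have key : ∀ a b : α, (of a * of b).toWord = [(a, true), (b, true)] := by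
    intro a b
    change (mk [(a, true), (b, true)]).toWord = _
    rw [toWord_mk]
    exact IsReduced.reduce_eq (by simp)
  rw [key, key] at h1
  simp at h1
  exact h1.1

/-- Commuting elements of a free group are powers of a common element. -/
theorem exists_mem_zpowers_of_commute {α : Type*} {x y : FreeGroup α} (h : Commute x y) :
    ∃ z, x ∈ Subgroup.zpowers z ∧ y ∈ Subgroup.zpowers z := by
  classical
  let S : Subgroup (FreeGroup α) := Subgroup.closure {x, y}
  have hS : ∀ a b : S, a * b = b * a := by
    have hc := Subgroup.isMulCommutative_closure (k := ({x, y} : Set (FreeGroup α))) (by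
      rintro a (rfl | rfl) b (rfl | rfl)
      · rfl
      · exact h.eq
      · exact h.eq.symm
      · rfl)
    exact fun a b => hc.is_comm.comm a b
  -- By Nielsen–Schreier the abelian group `S` is free, hence on at most one generator, hence
  -- cyclic.
  let e : S ≃* FreeGroup (IsFreeGroup.Generators S) := IsFreeGroup.toFreeGroup S
  have hsub : Subsingleton (IsFreeGroup.Generators S) := ⟨fun a b => eq_of_commute_of (by
    have := congrArg e (hS (e.symm (of a)) (e.symm (of b)))
    rw [_root_.map_mul, _root_.map_mul, e.apply_symm_apply, e.apply_symm_apply] at this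
    exact this)⟩
  have hcyc : ∃ z : S, ∀ s : S, s ∈ Subgroup.zpowers z := by
    rcases isEmpty_or_nonempty (IsFreeGroup.Generators S) with hE | ⟨⟨i⟩⟩
    · exact ⟨1, fun s => ⟨0, e.injective (Subsingleton.elim _ _)⟩⟩
    · refine ⟨e.symm (of i), fun s => ?_⟩
      have : ∀ w : FreeGroup (IsFreeGroup.Generators S), w ∈ Subgroup.zpowers (of i) := by
        intro w
        induction w using FreeGroup.induction_on with
        | C1 => exact one_mem _
        | of j => rw [Subsingleton.elim j i]; exact Subgroup.mem_zpowers _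
        | inv_of j hj => exact inv_mem hj
        | mul a b ha hb => exact mul_mem ha hb
      obtain ⟨n, hn⟩ := this (e s)
      exact ⟨n, e.injective (by simpa using hn)⟩
  obtain ⟨z, hz⟩ := hcyc
  obtain ⟨m, hm⟩ := hz ⟨x, Subgroup.subset_closure (by simp)⟩
  obtain ⟨n, hn⟩ := hz ⟨y, Subgroup.subset_closure (by simp)⟩
  exact ⟨z, ⟨m, congrArg Subtype.val hm⟩, ⟨n, congrArg Subtype.val hn⟩⟩

/-- An element mapped to a generator of `ℤ` generates its centralizer. -/
theorem mem_zpowers_of_commute {α : Type*} {x y : FreeGroup α}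
    (φ : FreeGroup α →* Multiplicative ℤ) (hφ : φ x = Multiplicative.ofAdd 1) (h : Commute x y) :
    y ∈ Subgroup.zpowers x := by
  obtain ⟨z, ⟨m, hm⟩, hy⟩ := exists_mem_zpowers_of_commute h
  have h1 : m * Multiplicative.toAdd (φ z) = 1 := by
    have := congrArg φ hm
    rw [hφ] at this
    simpa using congrArg Multiplicative.toAdd this
  suffices hz : z ∈ Subgroup.zpowers x from Subgroup.zpowers_le.2 hz hy
  rcases Int.eq_one_or_neg_one_of_mul_eq_one h1 with rfl | rfl
  · exact ⟨1, by simpa using hm.symm⟩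
  · exact ⟨-1, by simpa using congrArg (·⁻¹) hm.symm⟩

/-- The conjugate is a power `x ^ k`; applying `φ` gives `k = 1`, so `u` itself commutes with `x`.
-/
theorem mem_zpowers_of_commute_conj {α : Type*} {x u : FreeGroup α}
    (φ : FreeGroup α →* Multiplicative ℤ) (hφ : φ x = Multiplicative.ofAdd 1)
    (h : Commute x (u * x * u⁻¹)) : u ∈ Subgroup.zpowers x := by
  obtain ⟨k, hk⟩ := mem_zpowers_of_commute φ hφ h
  have h1 := congrArg φ hk
  simp only [map_zpow, _root_.map_mul, _root_.map_inv] at h1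
  rw [mul_inv_cancel_comm, hφ] at h1
  have hk1 : k = 1 := by simpa using congrArg Multiplicative.toAdd h1
  subst hk1
  refine mem_zpowers_of_commute φ hφ ?_
  have hk' : x = u * x * u⁻¹ := by simpa using hk
  change x * u = u * x
  exact (eq_mul_inv_iff_mul_eq.1 hk')

theorem continuous_lift_apply {G : Type*} [Group G] [TopologicalSpace G] [IsTopologicalGroup G]
    {n : ℕ} (w : FreeGroup (Fin n)) : Continuous fun g : Fin n → G => FreeGroup.lift g w := by
  induction w using FreeGroup.induction_on with
  | C1 => simpa using continuous_const
  | of i => simpa using continuous_apply i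
  | inv_of i h => simpa only [_root_.map_inv] using h.fun_inv
  | mul a b ha hb => simpa only [_root_.map_mul] using ha.fun_mul hb

end FreeGroup

/-! ### Density of pairs satisfying a relation -/

namespace HomeoPlus

/-- Pairs satisfying a nontrivial relation are dense. -/
theorem exists_mem_relation {U : Set (Fin 2 → HomeoPlus)} (hU : IsOpen U) (hne : U.Nonempty) :
    ∃ g ∈ U, ∃ w : FreeGroup (Fin 2), w ≠ 1 ∧ FreeGroup.lift g w = 1 := by
  obtain ⟨g, hgU, α, ω, hα0, hαω, hω1, hgα, hgω, hfix⟩ := exists_mem_no_common_fixedPoint hU hne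
  obtain ⟨u, hu⟩ := exists_lift_apply_lt hfix hω1 hα0
  -- At `g` this word is the identity outside `[α, ω]`. As `u` takes `ω` below `α`, its conjugate by
  -- `u` is the identity above `α`, so the two commute.
  let x : FreeGroup (Fin 2) := (FreeGroup.of 1)⁻¹ * FreeGroup.of 0
  let X : HomeoPlus := FreeGroup.lift g x
  let V : HomeoPlus := FreeGroup.lift g u
  have hX (t : unitInterval) : X.1 t = ((g 1)⁻¹).1 ((g 0).1 t) := by
    simp only [X, x, map_mul, map_inv, FreeGroup.lift_apply_of, mul_apply]
  have hXα (t : unitInterval) (ht : t ≤ α) : X.1 t = t := by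
    rw [hX, hgα t ht, inv_apply_self]
  have hXω (t : unitInterval) (ht : ω ≤ t) : X.1 t = t := by
    rw [hX, hgω t ht, inv_apply_self]
  have hV : ω < (V⁻¹).1 α := by
    have := strictMono V⁻¹ hu
    rwa [inv_apply_self] at this
  have hY (t : unitInterval) (ht : α ≤ t) : (V * X * V⁻¹).1 t = t := by
    rw [mul_apply, mul_apply, hXω _ (hV.le.trans ((strictMono V⁻¹).monotone ht)), apply_inv_self]
  have hcomm : Commute X (V * X * V⁻¹) := by
    refine ext_apply fun t => ?_
    rw [mul_apply X, mul_apply _ X]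
    rcases le_total t α with ht | ht
    · rw [hXα t ht, hXα]
      have := (strictMono (V * X * V⁻¹)).monotone ht
      rwa [hY α le_rfl] at this
    · rw [hY t ht, hY]
      have := (strictMono X).monotone ht
      rwa [hXα α le_rfl] at this
  refine ⟨g, hgU, x * (u * x * u⁻¹) * x⁻¹ * (u * x * u⁻¹)⁻¹, fun h => ?_, ?_⟩
  · have hc : Commute x (u * x * u⁻¹) := by
      have h2 := mul_inv_eq_one.1 h
      exact mul_inv_eq_iff_eq_mul.1 h2
    -- The homomorphism is the exponent sum of generator `0`, equal to `1` on `x`. If the relation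
    -- were trivial, `u` would be a power of `x` and fix `ω`, but it moves `ω`.
    obtain ⟨k, hk⟩ := FreeGroup.mem_zpowers_of_commute_conj
      (FreeGroup.lift fun i : Fin 2 => if i = 0 then Multiplicative.ofAdd (1 : ℤ) else 1)
      (by simp [x]) hc
    have hVk : V = X ^ k := by
      simp only [V, ← hk, map_zpow, X]
    have hk : ∀ k : ℤ, (X ^ k).1 ω = ω := by
      intro k
      have h1 : X.1 ω = ω := hXω ω le_rfl
      let F : Subgroup HomeoPlus :=
        { carrier := {f | f.1 ω = ω}
          one_mem' := rfl
          mul_mem' := fun {a b} ha hb => (congrArg a.1 hb).trans ha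
          inv_mem' := fun {a} ha => (inv_apply_eq_iff a ω ω).2 ha }
      exact zpow_mem (show X ∈ F from h1) k
    have := hk k
    rw [← hVk] at this
    exact absurd (hu.trans hαω) (by change ¬ V.1 ω < ω; rw [this]; exact lt_irrefl _)
  · simp only [map_mul, map_inv]
    change X * (V * X * V⁻¹) * X⁻¹ * (V * X * V⁻¹)⁻¹ = 1
    rw [hcomm.eq]; group

end HomeoPlus

/-! ### Descending trajectories under finitely many constraints -/

namespace HomeoPlus

open Filter Topology

/-- The value of a letter of a free group word at a tuple. -/
def letter {n : ℕ} (g : Fin n → HomeoPlus) (l : Fin n × Bool) : HomeoPlus :=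
  cond l.2 (g l.1) (g l.1)⁻¹

/-- The image of a point under the word `L`, whose last letter acts first. -/
def act {n : ℕ} (g : Fin n → HomeoPlus) (L : List (Fin n × Bool)) (x : unitInterval) :
    unitInterval :=
  (FreeGroup.lift g (FreeGroup.mk L)).1 x

theorem act_cons {n : ℕ} (g : Fin n → HomeoPlus) (l : Fin n × Bool) (L : List (Fin n × Bool))
    (x : unitInterval) : act g (l :: L) x = (letter g l).1 (act g L x) := by
  simp only [act, FreeGroup.lift_mk, List.map_cons, List.prod_cons]
  rfl

/-- The constraint `(i, p, q)`, meaning `g i p = q`, that makes the letter `l` map `x` to `y`. -/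
def constraint {n : ℕ} (l : Fin n × Bool) (x y : unitInterval) :
    Fin n × unitInterval × unitInterval :=
  (l.1, cond l.2 x y, cond l.2 y x)

/-- The tuple `g` satisfies all constraints `g i p = q` with `(i, p, q)` in `P`. -/
def Satisfies {n : ℕ} (g : Fin n → HomeoPlus) (P : Finset (Fin n × unitInterval × unitInterval)) :
    Prop :=
  ∀ c ∈ P, (g c.1).1 c.2.1 = c.2.2

theorem constraint_iff {n : ℕ} (g : Fin n → HomeoPlus) (l : Fin n × Bool) (x y : unitInterval) :
    (g (constraint l x y).1).1 (constraint l x y).2.1 = (constraint l x y).2.2 ↔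
      (letter g l).1 x = y := by
  obtain ⟨i, _ | _⟩ := l
  · exact (inv_apply_eq_iff (g i) x y).symm
  · exact Iff.rfl

theorem Satisfies.exists_letter_lt {n : ℕ} {g : Fin n → HomeoPlus}
    {P : Finset (Fin n × unitInterval × unitInterval)} (hP : Satisfies g P) {y : unitInterval}
    (hy0 : 0 < y) (hy1 : y < 1) (l : Fin n × Bool)
    (hl : ∀ c ∈ P, c.1 = l.1 → y < cond l.2 c.2.1 c.2.2) :
    ∃ g' : Fin n → HomeoPlus, Satisfies g' P ∧
      ∃ y', 0 < y' ∧ y' < y ∧ (letter g' l).1 y = y' := by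
  classical
  obtain ⟨z, hyz, hz⟩ : ∃ z, y < z ∧ ∀ c ∈ P, c.1 = l.1 → z ≤ cond l.2 c.2.1 c.2.2 := by
    let T : Finset unitInterval :=
      insert 1 ((P.filter fun c => c.1 = l.1).image fun c => cond l.2 c.2.1 c.2.2)
    have hT : T.Nonempty := ⟨1, Finset.mem_insert_self _ _⟩
    refine ⟨T.min' hT, (Finset.lt_min'_iff _ _).2 fun t ht => ?_, fun c hc hcl =>
      Finset.min'_le _ _ (Finset.mem_insert_of_mem
        (Finset.mem_image_of_mem _ (Finset.mem_filter.2 ⟨hc, hcl⟩)))⟩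
    rcases Finset.mem_insert.1 ht with rfl | ht
    · exact hy1
    · obtain ⟨c, hc, rfl⟩ := Finset.mem_image.1 ht
      exact hl c (Finset.mem_filter.1 hc).1 (Finset.mem_filter.1 hc).2
  -- Composing first with a map that takes `y` to `x` and is the identity above `z` keeps all
  -- constraints and sends `y` to the image of `x`, which is below `y`.
  obtain ⟨x, hx0, hx⟩ := exists_between (show 0 < min y (((letter g l)⁻¹).1 y) from
    lt_min hy0 (apply_pos _ hy0))
  obtain ⟨hxy, hx⟩ := lt_min_iff.1 hx
  obtain ⟨m, hmy, -, hmz⟩ := exists_apply_eq_of_mem_Ioo (a := 0) (b := z) (p := y) (q := x)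
    ⟨hy0, hyz⟩ ⟨hx0, hxy.trans hyz⟩
  let k : HomeoPlus := letter g l * m
  let g' : Fin n → HomeoPlus := Function.update g l.1 (cond l.2 k k⁻¹)
  have hk : letter g' l = k := by
    obtain ⟨i, _ | _⟩ := l <;> simp [letter, g']
  refine ⟨g', fun c hc => ?_, k.1 y, apply_pos _ hy0, ?_, by rw [hk]⟩
  · by_cases hcl : c.1 = l.1
    · have h1 := hz c hc hcl
      have h2 := hP c hc
      obtain ⟨i, p, q⟩ := c
      obtain ⟨j, b⟩ := l
      obtain rfl : i = j := hcl
      have h3 : k.1 (cond b p q) = cond b q p := by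
        rw [mul_apply, hmz _ h1]
        cases b
        · exact (inv_apply_eq_iff _ _ _).2 h2
        · exact h2
      cases b
      · simp only [g', Function.update_self]
        exact (inv_apply_eq_iff _ _ _).2 h3
      · simp only [g', Function.update_self]
        exact h3
    · rw [show g' c.1 = g c.1 from Function.update_of_ne hcl _ _]
      exact hP c hc
  · have := strictMono (letter g l) hx
    rw [apply_inv_self] at this
    rwa [mul_apply, hmy]

/-- Some finite set of constraints forces membership in `U` and makes the word `L` map `s` to a
point below `t`, from which any letter keeping `L` reduced may still move it down freely. -/
def HasDescent {n : ℕ} (U : Set (Fin n → HomeoPlus)) (s t : unitInterval) :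
    List (Fin n × Bool) → Prop
  | [] => False
  | l :: L => ∃ (g : Fin n → HomeoPlus) (P : Finset (Fin n × unitInterval × unitInterval))
      (y : unitInterval), 0 < y ∧ y < t ∧ Satisfies g P ∧
      (∀ g', Satisfies g' P → g' ∈ U ∧ act g' (l :: L) s = y) ∧
      (∀ c ∈ P, y ≤ c.2.1 ∧ y ≤ c.2.2) ∧
      ∀ l' : Fin n × Bool, (l'.1 = l.1 → l'.2 = l.2) →
        ∀ c ∈ P, c.1 = l'.1 → y < cond l'.2 c.2.1 c.2.2

theorem le_constraint {n : ℕ} {l : Fin n × Bool} {x y z : unitInterval} (hx : z ≤ x)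
    (hy : z ≤ y) : z ≤ (constraint l x y).2.1 ∧ z ≤ (constraint l x y).2.2 := by
  obtain ⟨i, _ | _⟩ := l
  · exact ⟨hy, hx⟩
  · exact ⟨hx, hy⟩

theorem lt_cond_constraint {n : ℕ} {l l' : Fin n × Bool} (h : l'.1 = l.1 → l'.2 = l.2)
    {x y z : unitInterval} (hx : z < x) (hc : (constraint l x y).1 = l'.1) :
    z < cond l'.2 (constraint l x y).2.1 (constraint l x y).2.2 := by
  rw [h hc.symm]
  obtain ⟨i, _ | _⟩ := l <;> exact hx

/-- No constraint prescribes the image of the current point under `l'`, which can therefore be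
lowered. The new constraint lies weakly below the old ones, and only the inverse of `l'` would have
its lowest point as source; reducedness excludes that letter. -/
theorem HasDescent.cons {n : ℕ} {U : Set (Fin n → HomeoPlus)} {s t : unitInterval}
    {l l' : Fin n × Bool} {L : List (Fin n × Bool)} (h : HasDescent U s t (l :: L))
    (hl : l'.1 = l.1 → l'.2 = l.2) : HasDescent U s t (l' :: l :: L) := by
  classical
  obtain ⟨g, P, y, hy0, hyt, hg, hU, hle, hlt⟩ := h
  obtain ⟨g', hg', y', hy'0, hy', hly⟩ := hg.exists_letter_lt hy0
    (hyt.trans_le unitInterval.le_one') l' (hlt l' hl)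
  refine ⟨g', insert (constraint l' y y') P, y', hy'0, hy'.trans hyt, ?_, ?_, ?_, ?_⟩
  · intro c hc
    rcases Finset.mem_insert.1 hc with rfl | hc
    · exact (constraint_iff g' l' y y').2 hly
    · exact hg' c hc
  · intro k hk
    obtain ⟨h1, h2⟩ := hU k fun c hc => hk c (Finset.mem_insert_of_mem hc)
    refine ⟨h1, ?_⟩
    rw [act_cons, h2]
    exact (constraint_iff k l' y y').1 (hk _ (Finset.mem_insert_self _ _))
  · intro c hc
    rcases Finset.mem_insert.1 hc with rfl | hc
    · exact le_constraint hy'.le le_rfl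
    · exact ⟨hy'.le.trans (hle c hc).1, hy'.le.trans (hle c hc).2⟩
  · intro l'' hl'' c hc hcl
    rcases Finset.mem_insert.1 hc with rfl | hc
    · exact lt_cond_constraint hl'' hy' hcl
    · have := hle c hc
      cases l''.2
      · exact hy'.trans_le this.2
      · exact hy'.trans_le this.1

theorem HasDescent.append {n : ℕ} {U : Set (Fin n → HomeoPlus)} {s t : unitInterval}
    {L : List (Fin n × Bool)} (h : HasDescent U s t L) (M : List (Fin n × Bool))
    (hM : FreeGroup.IsReduced (M ++ L)) : HasDescent U s t (M ++ L) := by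
  induction M with
  | nil => exact h
  | cons l M ih =>
    rw [List.cons_append] at hM ⊢
    have ih := ih hM.tail
    rcases hML : M ++ L with _ | ⟨l', L'⟩
    · rw [hML] at ih
      exact ih.elim
    · rw [hML] at ih hM
      exact ih.cons (FreeGroup.isReduced_cons_cons.1 hM).1

theorem HasDescent.exists_mem {n : ℕ} {U : Set (Fin n → HomeoPlus)} {s t : unitInterval}
    {L : List (Fin n × Bool)} (h : HasDescent U s t L) : ∃ g ∈ U, act g L s < t := by
  rcases L with _ | ⟨l, L⟩
  · exact h.elim
  · obtain ⟨g, P, y, -, hyt, hg, hU, -⟩ := h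
    obtain ⟨h1, h2⟩ := hU g hg
    exact ⟨g, h1, h2.trans_lt hyt⟩

open Classical in
/-- The constraints that prescribe the trajectory of `s` under the word `L` evaluated at `h`. -/
noncomputable def pathConstraints {n : ℕ} (h : Fin n → HomeoPlus) (s : unitInterval) :
    List (Fin n × Bool) → Finset (Fin n × unitInterval × unitInterval)
  | [] => ∅
  | l :: L => insert (constraint l (act h L s) (act h (l :: L) s)) (pathConstraints h s L)

theorem satisfies_pathConstraints {n : ℕ} (h : Fin n → HomeoPlus) (s : unitInterval)
    (L : List (Fin n × Bool)) : Satisfies h (pathConstraints h s L) := by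
  classical
  induction L with
  | nil => exact fun c hc => by simp [pathConstraints] at hc
  | cons l L ih =>
    intro c hc
    rcases Finset.mem_insert.1 hc with rfl | hc
    · exact (constraint_iff _ _ _ _).2 (act_cons h l L s).symm
    · exact ih c hc

theorem act_eq_of_satisfies {n : ℕ} {g h : Fin n → HomeoPlus} {s : unitInterval}
    {L : List (Fin n × Bool)} (hg : Satisfies g (pathConstraints h s L)) :
    act g L s = act h L s := by
  classical
  induction L with
  | nil => rfl
  | cons l L ih =>
    rw [act_cons, ih fun c hc => hg c (Finset.mem_insert_of_mem hc)]
    exact (constraint_iff _ _ _ _).1 (hg _ (Finset.mem_insert_self _ _))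

theorem le_of_mem_pathConstraints {n : ℕ} {h : Fin n → HomeoPlus} {s δ : unitInterval}
    {L : List (Fin n × Bool)} (hL : ∀ M, M <:+ L → δ ≤ act h M s) :
    ∀ c ∈ pathConstraints h s L, δ ≤ c.2.1 ∧ δ ≤ c.2.2 := by
  classical
  induction L with
  | nil => exact fun c hc => by simp [pathConstraints] at hc
  | cons l L ih =>
    intro c hc
    rcases Finset.mem_insert.1 hc with rfl | hc
    · exact le_constraint (hL L (List.suffix_cons l L)) (hL _ List.suffix_rfl)
    · exact ih (fun M hM => hL M (hM.trans (List.suffix_cons l L))) c hc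

/-- Take a shortest word moving `s` below `δ`, a lower bound for `t` and all positive points that
matter for `U`. By minimality its proper suffixes keep `s` at or above `δ`, so the endpoint lies
below all earlier constraints. -/
theorem exists_hasDescent {U : Set (Fin 2 → HomeoPlus)} (hU : IsOpen U) (hne : U.Nonempty)
    {s t : unitInterval} (ht : 0 < t) (hts : t < s) (hs : s < 1) :
    ∃ l L, FreeGroup.IsReduced (l :: L) ∧ HasDescent U s t (l :: L) := by
  classical
  obtain ⟨h, hhU, -, -, -, -, -, -, -, hfix⟩ := exists_mem_no_common_fixedPoint hU hne
  obtain ⟨A, hA⟩ := exists_finset_of_isOpen hU hhU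
  -- The point `0` is dropped: its value is automatic, and it would force `δ = 0`.
  let B : Finset unitInterval := A.filter fun a => 0 < a
  let T : Finset unitInterval := insert t (B ∪ Finset.univ.biUnion fun i => B.image (h i).1)
  have hT : T.Nonempty := ⟨t, Finset.mem_insert_self _ _⟩
  have hT0 : ∀ a ∈ T, 0 < a := by
    intro a ha
    rcases Finset.mem_insert.1 ha with rfl | ha
    · exact ht
    rcases Finset.mem_union.1 ha with ha | ha
    · exact (Finset.mem_filter.1 ha).2
    · obtain ⟨i, -, hi⟩ := Finset.mem_biUnion.1 ha
      obtain ⟨b, hb, rfl⟩ := Finset.mem_image.1 hi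
      exact apply_pos _ (Finset.mem_filter.1 hb).2
  let δ := T.min' hT
  have hδ : ∀ a ∈ T, δ ≤ a := fun a ha => T.min'_le a ha
  have hδ0 : 0 < δ := hT0 _ (T.min'_mem hT)
  have hδt : δ ≤ t := hδ t (Finset.mem_insert_self _ _)
  have hex : ∃ N, ∃ w : FreeGroup (Fin 2), w.norm = N ∧ (FreeGroup.lift h w).1 s < δ := by
    obtain ⟨w, hw⟩ := exists_lift_apply_lt hfix hs hδ0
    exact ⟨_, w, rfl, hw⟩
  obtain ⟨w, hwN, hw⟩ := Nat.find_spec hex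
  have hmin : ∀ v : FreeGroup (Fin 2), v.norm < w.norm → δ ≤ (FreeGroup.lift h v).1 s := by
    intro v hv
    by_contra hlt
    exact Nat.find_min hex (hwN ▸ hv) ⟨v, rfl, not_le.1 hlt⟩
  rcases hwL : w.toWord with _ | ⟨l, L⟩
  · rw [FreeGroup.toWord_eq_nil_iff] at hwL
    rw [hwL, map_one, one_apply] at hw
    exact absurd (hw.trans_le (hδt.trans hts.le)) (lt_irrefl _)
  have hact : act h (l :: L) s < δ := by
    rwa [act, ← hwL, FreeGroup.mk_toWord]
  have hsuf : ∀ M, M <:+ L → δ ≤ act h M s := by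
    intro M hM
    refine hmin _ (FreeGroup.norm_mk_le.trans_lt ?_)
    rw [FreeGroup.norm, hwL]
    exact Nat.lt_succ_of_le hM.length_le
  let P₀ : Finset (Fin 2 × unitInterval × unitInterval) :=
    Finset.univ.biUnion fun i => B.image fun a => (i, a, (h i).1 a)
  have hP₀ : ∀ c ∈ P₀, (h c.1).1 c.2.1 = c.2.2 ∧ δ ≤ c.2.1 ∧ δ ≤ c.2.2 := by
    intro c hc
    obtain ⟨i, -, hi⟩ := Finset.mem_biUnion.1 hc
    obtain ⟨a, ha, rfl⟩ := Finset.mem_image.1 hi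
    refine ⟨rfl, hδ _ (Finset.mem_insert_of_mem (Finset.mem_union_left _ ha)),
      hδ _ (Finset.mem_insert_of_mem (Finset.mem_union_right _ (Finset.mem_biUnion.2
        ⟨i, Finset.mem_univ i, Finset.mem_image_of_mem _ ha⟩)))⟩
  have hpath := le_of_mem_pathConstraints hsuf
  have hold : ∀ c ∈ P₀ ∪ pathConstraints h s L, δ ≤ c.2.1 ∧ δ ≤ c.2.2 := by
    intro c hc
    rcases Finset.mem_union.1 hc with hc | hc
    · exact (hP₀ c hc).2
    · exact hpath c hc
  have hmem : ∀ c ∈ P₀ ∪ pathConstraints h s (l :: L),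
      c = constraint l (act h L s) (act h (l :: L) s) ∨ c ∈ P₀ ∪ pathConstraints h s L := by
    intro c hc
    rcases Finset.mem_union.1 hc with hc | hc
    · exact Or.inr (Finset.mem_union_left _ hc)
    · rcases Finset.mem_insert.1 hc with hc | hc
      · exact Or.inl hc
      · exact Or.inr (Finset.mem_union_right _ hc)
  have hlt : act h (l :: L) s < act h L s := hact.trans_le (hsuf L List.suffix_rfl)
  refine ⟨l, L, hwL ▸ FreeGroup.isReduced_toWord, h, P₀ ∪ pathConstraints h s (l :: L),
    act h (l :: L) s, apply_pos _ (ht.trans hts), hact.trans_le hδt, ?_, ?_, ?_, ?_⟩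
  · intro c hc
    rcases Finset.mem_union.1 hc with hc | hc
    · exact (hP₀ c hc).1
    · exact satisfies_pathConstraints h s _ c hc
  · intro g hg
    refine ⟨hA g fun i a ha => ?_,
      act_eq_of_satisfies fun c hc => hg c (Finset.mem_union_right _ hc)⟩
    rcases eq_or_lt_of_le (unitInterval.nonneg' (t := a)) with rfl | ha0
    · rw [apply_zero, apply_zero]
    · exact hg (i, a, (h i).1 a) (Finset.mem_union_left _ (Finset.mem_biUnion.2
        ⟨i, Finset.mem_univ i, Finset.mem_image_of_mem _ (Finset.mem_filter.2 ⟨ha, ha0⟩)⟩))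
  · intro c hc
    rcases hmem c hc with rfl | hc
    · exact le_constraint hlt.le le_rfl
    · exact ⟨hact.le.trans (hold c hc).1, hact.le.trans (hold c hc).2⟩
  · intro l' hl' c hc hcl
    rcases hmem c hc with rfl | hc
    · exact lt_cond_constraint hl' hlt hcl
    · have := hold c hc
      cases l'.2
      · exact hact.trans_le this.2
      · exact hact.trans_le this.1

end HomeoPlus

/-- Conjugate by `p :: l :: L`. Cancellation is excluded if `p` avoids the inverse of `l`, the
inverse of the last letter of `w`, and the first letter of `w`: three of the four letters. -/
theorem FreeGroup.exists_isReduced_conj {L : List (Fin 2 × Bool)} {l : Fin 2 × Bool}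
    (hL : FreeGroup.IsReduced (l :: L)) {w : FreeGroup (Fin 2)} (hw : w ≠ 1) :
    ∃ (p : Fin 2 × Bool) (M : List (Fin 2 × Bool)), FreeGroup.IsReduced (M ++ l :: L) ∧
      FreeGroup.mk (M ++ l :: L) =
        (FreeGroup.mk (p :: l :: L))⁻¹ * w * FreeGroup.mk (p :: l :: L) := by
  have hwne : w.toWord ≠ [] := fun h => hw (FreeGroup.toWord_eq_nil_iff.1 h)
  have hp : ∀ l x y : Fin 2 × Bool, ∃ p : Fin 2 × Bool, (p.1 = l.1 → p.2 = l.2) ∧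
      (x.1 = p.1 → x.2 = p.2) ∧ (p.1 = y.1 → (!p.2) = y.2) := by decide
  obtain ⟨p, hpl, hpx, hpy⟩ := hp l (w.toWord.getLast hwne) (w.toWord.head hwne)
  have hpL : FreeGroup.IsReduced (p :: l :: L) := FreeGroup.isReduced_cons_cons.2 ⟨hpl, hL⟩
  have hinv : FreeGroup.IsReduced (FreeGroup.invRev (p :: l :: L)) := by
    rw [FreeGroup.isReduced_iff_reduce_eq, FreeGroup.reduce_invRev, hpL.reduce_eq]
  refine ⟨p, FreeGroup.invRev (p :: l :: L) ++ w.toWord ++ [p], ?_, ?_⟩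
  · rw [List.append_assoc, List.singleton_append]
    refine List.isChain_append.2 ⟨List.isChain_append.2 ⟨hinv, FreeGroup.isReduced_toWord, ?_⟩,
      hpL, ?_⟩
    · intro x hx y hy
      have hx' : x = (p.1, !p.2) := by
        simpa [FreeGroup.invRev, eq_comm] using hx
      rw [List.head?_eq_some_head hwne] at hy
      obtain rfl : w.toWord.head hwne = y := by simpa using hy
      subst hx'
      exact hpy
    · intro x hx y hy
      rw [List.getLast?_append_of_ne_nil _ hwne, List.getLast?_eq_some_getLast hwne] at hx
      obtain rfl : w.toWord.getLast hwne = x := by simpa using hx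
      obtain rfl : p = y := by simpa using hy
      exact hpx
  · rw [List.append_assoc, List.singleton_append, ← FreeGroup.mul_mk, ← FreeGroup.mul_mk,
      FreeGroup.mk_toWord, FreeGroup.inv_mk]

/-! ### Topological similarity and the category argument -/

section

open Filter Topology

variable {G : Type*} [Group G] [TopologicalSpace G] [IsTopologicalGroup G] {n : ℕ}

theorem TopologicallySimilar.symm {g f : Fin n → G} (h : TopologicallySimilar g f) :
    TopologicallySimilar f g := by
  obtain ⟨F, hF⟩ := h
  exact ⟨F.symm, fun i => by rw [← hF i]; exact F.symm_apply_apply _⟩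

/-- Words that are small at `g` are small at any topologically similar tuple `f`. -/
theorem TopologicallySimilar.exists_mem_nhds {g f : Fin n → G} (h : TopologicallySimilar g f)
    {V : Set G} (hV : V ∈ 𝓝 1) :
    ∃ V' ∈ 𝓝 (1 : G), ∀ w, FreeGroup.lift g w ∈ V' → FreeGroup.lift f w ∈ V := by
  obtain ⟨F, hF⟩ := h
  let γ (k : Fin n → G) : FreeGroup (Fin n) →* Subgroup.closure (Set.range k) :=
    FreeGroup.lift fun i => ⟨k i, Subgroup.subset_closure (Set.mem_range_self i)⟩
  have hγ (k : Fin n → G) (w : FreeGroup (Fin n)) : (γ k w : G) = FreeGroup.lift k w := by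
    have : (Subgroup.closure (Set.range k)).subtype.comp (γ k) = FreeGroup.lift k :=
      FreeGroup.ext_hom _ _ fun i => by simp [γ]
    exact DFunLike.congr_fun this w
  have hFγ (w : FreeGroup (Fin n)) : F (γ g w) = γ f w := by
    have : F.toMulEquiv.toMonoidHom.comp (γ g) = γ f :=
      FreeGroup.ext_hom _ _ fun i => by
        simp only [γ, MonoidHom.comp_apply, FreeGroup.lift_apply_of]
        exact hF i
    exact DFunLike.congr_fun this w
  have hc : Continuous fun x : Subgroup.closure (Set.range g) => (F x : G) :=
    continuous_subtype_val.comp F.continuous_toFun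
  have h1 : (fun x : Subgroup.closure (Set.range g) => (F x : G)) ⁻¹' V ∈ 𝓝 1 :=
    hc.continuousAt.preimage_mem_nhds (by simpa using hV)
  obtain ⟨V', hV', hsub⟩ := mem_nhds_induced (Subtype.val) _ _ |>.1 h1
  refine ⟨V', hV', fun w hw => ?_⟩
  rw [← hγ, ← hFγ]
  exact hsub (show ((γ g w : Subgroup.closure (Set.range g)) : G) ∈ V' by rwa [hγ])

end

namespace HomeoPlus

open Filter Topology

/-- If nontrivial words in `f` accumulate at the identity, then some word small at
`f` moves a given point far away for some tuple in any given open set. -/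
theorem exists_mem_lift_apply_lt {U : Set (Fin 2 → HomeoPlus)} (hU : IsOpen U) (hne : U.Nonempty)
    {s t : unitInterval} (ht : 0 < t) (hts : t < s) (hs : s < 1) {f : Fin 2 → HomeoPlus}
    (hf : ∀ V ∈ 𝓝 (1 : HomeoPlus), ∃ w : FreeGroup (Fin 2), w ≠ 1 ∧ FreeGroup.lift f w ∈ V)
    {V : Set HomeoPlus} (hV : V ∈ 𝓝 1) :
    ∃ w : FreeGroup (Fin 2), FreeGroup.lift f w ∈ V ∧ ∃ g ∈ U, (FreeGroup.lift g w).1 s < t := by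
  obtain ⟨l, L, hL, hdesc⟩ := exists_hasDescent hU hne ht hts hs
  have hconj (a : HomeoPlus) : {h : HomeoPlus | a⁻¹ * h * a ∈ V} ∈ 𝓝 (1 : HomeoPlus) := by
    have hc : Continuous fun h : HomeoPlus => a⁻¹ * h * a := by fun_prop
    exact hc.continuousAt.preimage_mem_nhds (by simpa using hV)
  -- The letter `p` depends on `w`, so `w` is taken small enough for all four conjugators at once.
  obtain ⟨w, hw, hwV⟩ := hf (⋂ p : Fin 2 × Bool,
    {h | (FreeGroup.lift f (FreeGroup.mk (p :: l :: L)))⁻¹ * h *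
      FreeGroup.lift f (FreeGroup.mk (p :: l :: L)) ∈ V}) (iInter_mem.2 fun p => hconj _)
  obtain ⟨p, M, hred, hM⟩ := FreeGroup.exists_isReduced_conj hL hw
  refine ⟨FreeGroup.mk (M ++ l :: L), ?_, (hdesc.append M hred).exists_mem⟩
  rw [hM, map_mul, map_mul, map_inv]
  exact Set.mem_iInter.1 hwV p

end HomeoPlus

open HomeoPlus Filter Topology in
theorem mainTheorem3 (f : Fin 2 → HomeoPlus) : IsMeagre (similarityClass f) := by
  obtain ⟨V, hV⟩ := (𝓝 (1 : HomeoPlus)).exists_antitone_basis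
  have hnd {A : Set (Fin 2 → HomeoPlus)} (hA : IsClosed A)
      (hA' : ∀ U, IsOpen U → U.Nonempty → ∃ g ∈ U, g ∉ A) : IsMeagre A := by
    refine IsNowhereDense.isMeagre (hA.isNowhereDense_iff.2 ?_)
    by_contra hne
    obtain ⟨g, hg, hgA⟩ := hA' _ isOpen_interior (Set.nonempty_iff_ne_empty.2 hne)
    exact hgA (interior_subset hg)
  -- The negation says that `f` freely generates a discrete subgroup.
  by_cases hf : ∀ W ∈ 𝓝 (1 : HomeoPlus), ∃ w : FreeGroup (Fin 2), w ≠ 1 ∧ FreeGroup.lift f w ∈ W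
  · obtain ⟨s, hs0, hs1⟩ := exists_between (zero_lt_one (α := unitInterval))
    obtain ⟨t, ht0, hts⟩ := exists_between hs0
    -- The weak inequality `t ≤ w(g)(s)` makes each set closed.
    have hm : IsMeagre (⋃ k, {g : Fin 2 → HomeoPlus |
        ∀ w, FreeGroup.lift f w ∈ V k → t ≤ (FreeGroup.lift g w).1 s}) := by
      refine isMeagre_iUnion fun k => hnd ?_ fun U hU hne => ?_
      · simp only [Set.ofPred_forall]
        refine isClosed_iInter fun w => isClosed_iInter fun _ => ?_
        exact isClosed_le continuous_const
          ((HomeoPlus.continuous_apply s).comp (FreeGroup.continuous_lift_apply w))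
      · obtain ⟨w, hw, g, hgU, hg⟩ := exists_mem_lift_apply_lt hU hne ht0 hts hs1 hf
          (hV.1.mem_of_mem trivial)
        exact ⟨g, hgU, fun hgA => not_le.2 hg (hgA w hw)⟩
    refine hm.mono fun g hg => ?_
    have hW : {h : HomeoPlus | t < h.1 s} ∈ 𝓝 (1 : HomeoPlus) :=
      (isOpen_lt continuous_const (HomeoPlus.continuous_apply s)).mem_nhds hts
    obtain ⟨W, hW, hWg⟩ := (TopologicallySimilar.symm hg).exists_mem_nhds hW
    obtain ⟨k, -, hk⟩ := hV.1.mem_iff.1 hW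
    exact Set.mem_iUnion.2 ⟨k, fun w hw => le_of_lt (hWg w (hk hw))⟩
  · push Not at hf
    obtain ⟨W, hW, hfW⟩ := hf
    -- Avoiding the interior of `V k`, rather than `V k`, makes each set closed.
    have hm : IsMeagre (⋃ k, {g : Fin 2 → HomeoPlus |
        ∀ w : FreeGroup (Fin 2), w ≠ 1 → FreeGroup.lift g w ∉ interior (V k)}) := by
      refine isMeagre_iUnion fun k => hnd ?_ fun U hU hne => ?_
      · simp only [Set.ofPred_forall]
        refine isClosed_iInter fun w => isClosed_iInter fun _ => ?_
        exact (isOpen_interior.preimage (FreeGroup.continuous_lift_apply w)).isClosed_compl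
      · obtain ⟨g, hgU, w, hw, hgw⟩ := exists_mem_relation hU hne
        refine ⟨g, hgU, fun hgA => hgA w hw ?_⟩
        rw [hgw]
        exact mem_interior_iff_mem_nhds.2 (hV.1.mem_of_mem trivial)
    refine hm.mono fun g hg => ?_
    obtain ⟨W', hW', hgW⟩ := TopologicallySimilar.exists_mem_nhds hg hW
    obtain ⟨k, -, hk⟩ := hV.1.mem_iff.1 hW'
    exact Set.mem_iUnion.2 ⟨k, fun w hw hwk => hfW w hw (hgW w (hk (interior_subset hwk)))⟩
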